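/- (p-biased invariance principle.) Let $\sigma_1,\dots,\sigma_n>0$, and let $\mathbf X=(X_1,\dots,X_n)$ and $\mathbf Y=(Y_1,\dots,Y_n)$ be random vectors (possibly on different probability spaces), each with independent real-valued coordinates, such that for every $i$ the variables $X_i$ and $Y_i$ have mean $0$ and variance $1$ and satisfy $\|X_i\|_3^3\le\sigma_i^{-1}$ and $\|Y_i\|_3^3\le\sigma_i^{-1}$, where $\|Z\|_3^3=\mathbb E|Z|^3$. Let $f\in\mathbb R[v_1,\dots,v_n]$ be a multilinear polynomial of degree at most $d$, and for $S\subset[n]$ let $\hat f(S)$ be the coefficient in $f$ of $v_S=\prod_{i\in S}v_i$. Put $$W_S(f)=\sum_{J\supseteq S}\hat f(J)^2,\qquad \mathrm I_S(f)=W_S(f)\prod_{i\in S}\sigma_i^{-2}.$$ Let $\phi:\mathbb R\to\mathbb R$ be three times continuously differentiable with $\|\phi'''\|_\infty=\sup_{x\in\mathbb R}|\phi'''(x)|<\infty$. If $\epsilon$ is a real number with $\mathrm I_S(f)\le\epsilon$ for every nonempty $S\subset[n]$, then $\phi(f(\mathbf X))$ and $\phi(f(\mathbf Y))$ are integrable and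 $$\bigl|\mathbb E[\phi(f(\mathbf X))]-\mathbb E[\phi(f(\mathbf Y))]\bigr|\le 2^{5d}\,\|\phi'''\|_\infty\,W_\emptyset(f)\,\sqrt\epsilon .$$ (If $n=0$ there is no nonempty $S$ and $\epsilon$ is unrestricted; then $\sqrt\epsilon$ is read as $0$ for $\epsilon<0$.) -/

import Mathlib

open MeasureTheory ProbabilityTheory

namespace Invariance

/-- A polynomial is multilinear if every variable occurs in it with degree at most one. -/
def IsMultilinear {n : ℕ} (f : MvPolynomial (Fin n) ℝ) : Prop :=
  ∀ i, f.degreeOf i ≤ 1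

/-- The coefficient in `f` of the monomial `v_S = ∏_{i ∈ S} v_i`. -/
noncomputable def monomialCoeff {n : ℕ} (f : MvPolynomial (Fin n) ℝ) (S : Finset (Fin n)) : ℝ :=
  f.coeff (∑ i ∈ S, Finsupp.single i 1)

/-- `W_S(f)`, the sum of the squared coefficients of `v_J` over all `J ⊇ S`. -/
noncomputable def upWeight {n : ℕ} (f : MvPolynomial (Fin n) ℝ) (S : Finset (Fin n)) : ℝ :=
  ∑ J : Finset (Fin n) with S ⊆ J, monomialCoeff f J ^ 2

/-- The generalised influence `I_S(f) = W_S(f) ∏_{i ∈ S} σ_i⁻²`. -/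
noncomputable def genInfluence {n : ℕ} (σ : Fin n → ℝ) (f : MvPolynomial (Fin n) ℝ)
    (S : Finset (Fin n)) : ℝ :=
  upWeight f S * ∏ i ∈ S, (σ i ^ 2)⁻¹

/-- A random vector with independent coordinates of mean `0` and variance `1`, whose `i`-th
coordinate satisfies `‖X_i‖₃³ ≤ σ_i⁻¹`. -/
structure IsAdmissible {n : ℕ} {Ω : Type*} [MeasurableSpace Ω] (P : Measure Ω)
    (σ : Fin n → ℝ) (X : Fin n → Ω → ℝ) : Prop where
  measurable : ∀ i, Measurable (X i)
  indep : iIndepFun X P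
  mean : ∀ i, ∫ ω, X i ω ∂P = 0
  variance : ∀ i, ProbabilityTheory.variance (X i) P = 1
  third_moment : ∀ i, eLpNorm (X i) 3 P ^ 3 ≤ ENNReal.ofReal (σ i)⁻¹

/-- The random variable `f(X)`. -/
noncomputable def evalAt {n : ℕ} {Ω : Type*} (f : MvPolynomial (Fin n) ℝ)
    (X : Fin n → Ω → ℝ) (ω : Ω) : ℝ :=
  MvPolynomial.eval (fun i => X i ω) f

/-- `‖φ'''‖_∞`, the supremum of `|φ'''|` (used for `φ` of class `C³` with `φ'''` bounded). -/
noncomputable def thirdDerivSup (φ : ℝ → ℝ) : ℝ :=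
  ⨆ x, |iteratedDeriv 3 φ x|

end Invariance

/-!
Lindeberg's method exchanges the coordinates one at a time. As a function of the `i`-th coordinate
`t`, the polynomial is `a + t * b` with `b = ∂_i f`, and since the laws have equal moments up to
order two, Taylor's formula bounds the error of the `i`-th exchange by a multiple of
`M * κ_i * E|∂_i f|³`, where `κ_i = σ_i⁻¹` and `M = ‖φ'''‖_∞`.

These third moments are in turn compared with third moments under random signs `r`: up to
`κ_j * |b|³`, `E|a + t * b|³` is at most `|a|³ + 3 * |a| * b²`, which random signs exceed by
convexity. Exchanging all coordinates in this way gives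
`E|F|³ ≤ ∑_S (∏_{j ∈ S} κ_j) * E|∂_S F(r)|³`. Hypercontractivity for random signs bounds the third
moments on the right by `L²` norms, that is, by `W_S(f)^{3/2}` up to factors exponential in the
degree. One of the three factors `W_S(f)^{1/2}` is combined with `∏_{j ∈ S} κ_j` to give at most
`√ε`, and the remaining `W_S(f)` sum to at most `2^d * W_∅(f)`.
-/

namespace Invariance

open Finset Function
open scoped ENNReal

section Multilinear

variable {ι R : Type*}

/-- The value at `x` of the multilinear polynomial `∑_J a_J v_J`. Multilinear polynomials are
encoded by their coefficient functions `a : Finset ι → R`. -/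
def multilinearEval [Fintype ι] [CommSemiring R] (a : Finset ι → R) (x : ι → R) : R :=
  ∑ J, a J * ∏ i ∈ J, x i

/-- The `L²` norm, under uniform random signs, of the multilinear polynomial `a` after rescaling
all variables by `√3`: the coefficients of degree `k` carry the weight `3 ^ k`. -/
noncomputable def weightedNorm [Fintype ι] (a : Finset ι → ℝ) : ℝ :=
  √(∑ J, 3 ^ #J * a J ^ 2)

lemma weightedNorm_nonneg [Fintype ι] (a : Finset ι → ℝ) : 0 ≤ weightedNorm a := Real.sqrt_nonneg _

lemma weightedNorm_zero [Fintype ι] : weightedNorm (0 : Finset ι → ℝ) = 0 := by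
  simp [weightedNorm]

lemma sq_weightedNorm [Fintype ι] (a : Finset ι → ℝ) :
    weightedNorm a ^ 2 = ∑ J, 3 ^ #J * a J ^ 2 :=
  Real.sq_sqrt (sum_nonneg fun _ _ => by positivity)

variable [DecidableEq ι]

/-- The part of a multilinear polynomial that does not involve `v_i`. -/
def dropVar [Zero R] (i : ι) (a : Finset ι → R) (J : Finset ι) : R :=
  if i ∈ J then 0 else a J

/-- The iterated partial derivative `∂_S` of a multilinear polynomial with respect to the variables
`v_i`, `i ∈ S`. -/
def derivOn [Zero R] (S : Finset ι) (a : Finset ι → R) (J : Finset ι) : R :=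
  if Disjoint S J then a (S ∪ J) else 0

section Zero

variable [Zero R] {i : ι} {S J : Finset ι} (a : Finset ι → R)

lemma dropVar_of_notMem (h : i ∉ J) : dropVar i a J = a J := if_neg h

lemma dropVar_insert (i : ι) (J : Finset ι) : dropVar i a (insert i J) = 0 :=
  if_pos (mem_insert_self i J)

lemma derivOn_empty : derivOn ∅ a = a := by
  ext J; simp [derivOn]

lemma derivOn_singleton_of_notMem (h : i ∉ J) : derivOn {i} a J = a (insert i J) := by
  rw [derivOn, if_pos (disjoint_singleton_left.2 h), insert_eq]

lemma derivOn_singleton_insert (i : ι) (J : Finset ι) : derivOn {i} a (insert i J) = 0 := by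
  simp [derivOn]

lemma derivOn_derivOn_singleton_of_notMem (h : i ∉ S) :
    derivOn S (derivOn {i} a) = derivOn (insert i S) a := by
  ext J
  by_cases hi : i ∈ J <;> by_cases hS : Disjoint S J <;> simp [derivOn, hi, hS, h]

lemma derivOn_derivOn_singleton_of_mem (h : i ∈ S) : derivOn S (derivOn {i} a) = 0 := by
  ext J
  simp [derivOn, h]

end Zero

lemma notMem_of_mem_powerset_erase {i : ι} {s J : Finset ι} (hJ : J ∈ (s.erase i).powerset) :
    i ∉ J :=
  fun h => notMem_erase i s (mem_powerset.1 hJ h)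

variable [Fintype ι]

lemma sum_eq_sum_powerset_erase {M : Type*} [AddCommMonoid M] (i : ι) (F : Finset ι → M) :
    ∑ J, F J = ∑ J ∈ (univ.erase i).powerset, (F J + F (insert i J)) := by
  rw [sum_add_distrib, ← sum_powerset_insert (notMem_erase i _), insert_erase (mem_univ i),
    powerset_univ]

lemma multilinearEval_update [CommSemiring R] (a : Finset ι → R) (x : ι → R) (i : ι) (t : R) :
    multilinearEval a (update x i t) =
      multilinearEval (dropVar i a) x + t * multilinearEval (derivOn {i} a) x := by
  simp only [multilinearEval]
  rw [sum_eq_sum_powerset_erase i, sum_eq_sum_powerset_erase i fun J => dropVar i a J * _,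
    sum_eq_sum_powerset_erase i fun J => derivOn {i} a J * _, mul_sum, ← sum_add_distrib]
  refine sum_congr rfl fun J hJ => ?_
  have hi : i ∉ J := notMem_of_mem_powerset_erase hJ
  rw [dropVar_insert, derivOn_singleton_insert, dropVar_of_notMem a hi,
    derivOn_singleton_of_notMem a hi, prod_insert hi, prod_update_of_notMem hi, update_self]
  ring

lemma sq_weightedNorm_eq_add (i : ι) (a : Finset ι → ℝ) :
    weightedNorm a ^ 2 = weightedNorm (dropVar i a) ^ 2 + 3 * weightedNorm (derivOn {i} a) ^ 2 := by
  simp only [sq_weightedNorm]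
  rw [sum_eq_sum_powerset_erase i, sum_eq_sum_powerset_erase i fun J => _ * dropVar i a J ^ 2,
    sum_eq_sum_powerset_erase i fun J => _ * derivOn {i} a J ^ 2, mul_sum, ← sum_add_distrib]
  refine sum_congr rfl fun J hJ => ?_
  have hi : i ∉ J := notMem_of_mem_powerset_erase hJ
  rw [dropVar_insert, derivOn_singleton_insert, dropVar_of_notMem a hi,
    derivOn_singleton_of_notMem a hi, card_insert_of_notMem hi]
  ring

end Multilinear

section ProductMeasure

variable {ι : Type*} [DecidableEq ι] {X : ι → Type*} [∀ i, MeasurableSpace (X i)]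

lemma isProbabilityMeasure_update (μ : ∀ i, Measure (X i)) [∀ i, IsProbabilityMeasure (μ i)] (i : ι)
    (ν : Measure (X i)) [hν : IsProbabilityMeasure ν] (j : ι) :
    IsProbabilityMeasure (update μ i ν j) := by
  rcases eq_or_ne j i with rfl | h
  · rwa [update_self]
  · rw [update_of_ne h]; infer_instance

variable [Fintype ι] (μ : ∀ i, Measure (X i)) [∀ i, IsProbabilityMeasure (μ i)] (i : ι)

lemma measurePreserving_update (ν : Measure (X i)) [IsProbabilityMeasure ν] :
    MeasurePreserving (fun p : (∀ i, X i) × X i => update p.1 i p.2)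
      ((Measure.pi μ).prod ν) (Measure.pi (update μ i ν)) := by
  have := isProbabilityMeasure_update μ i ν
  refine ⟨measurable_update', (Measure.pi_eq fun s hs => ?_).symm⟩
  have hpre : (fun p : (∀ i, X i) × X i => update p.1 i p.2) ⁻¹' Set.univ.pi s =
      Set.univ.pi (update s i Set.univ) ×ˢ s i := by
    ext p
    simp only [Set.mem_preimage, Set.mem_univ_pi, Set.mem_prod,
      forall_update_iff p.1 fun j y => y ∈ s j, forall_update_iff s fun j t => p.1 j ∈ t,
      Set.mem_univ, true_and, and_comm]
  rw [Measure.map_apply measurable_update' (MeasurableSet.univ_pi hs), hpre, Measure.prod_prod,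
    Measure.pi_pi, ← mul_prod_erase _ _ (mem_univ i), ← mul_prod_erase _ _ (mem_univ i),
    update_self, update_self, measure_univ, one_mul, mul_comm]
  congr 1
  refine prod_congr rfl fun j hj => ?_
  rw [update_of_ne (ne_of_mem_erase hj), update_of_ne (ne_of_mem_erase hj)]

variable {μ i} {E : Type*} [NormedAddCommGroup E] [NormedSpace ℝ E] {ν : Measure (X i)}
  [IsProbabilityMeasure ν] {F : (∀ i, X i) → E}

lemma integrable_integral_update (hF : Integrable F (Measure.pi (update μ i ν))) :
    Integrable (fun x => ∫ t, F (update x i t) ∂ν) (Measure.pi μ) :=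
  ((measurePreserving_update μ i ν).integrable_comp_of_integrable hF).integral_prod_left

lemma integral_pi_update (hF : Integrable F (Measure.pi (update μ i ν))) :
    ∫ x, F x ∂Measure.pi (update μ i ν) = ∫ x, ∫ t, F (update x i t) ∂ν ∂Measure.pi μ := by
  have hp := measurePreserving_update μ i ν
  rw [← hp.map_eq] at hF ⊢
  rw [integral_map hp.measurable.aemeasurable hF.aestronglyMeasurable]
  exact integral_prod _ (hF.comp_measurable hp.measurable)

lemma integral_pi_update_sub_le {F G : (∀ i, X i) → ℝ} {ν' : Measure (X i)}
    [IsProbabilityMeasure ν'] (hF : Integrable F (Measure.pi (update μ i ν)))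
    (hF' : Integrable F (Measure.pi (update μ i ν'))) (hG : Integrable G (Measure.pi μ))
    (hFG : ∀ x, ∫ t, F (update x i t) ∂ν - ∫ t, F (update x i t) ∂ν' ≤ G x) :
    ∫ x, F x ∂Measure.pi (update μ i ν) - ∫ x, F x ∂Measure.pi (update μ i ν') ≤
      ∫ x, G x ∂Measure.pi μ := by
  have hI := integrable_integral_update hF
  have hI' := integrable_integral_update hF'
  rw [integral_pi_update hF, integral_pi_update hF', ← integral_sub hI hI']
  exact integral_mono (hI.sub hI') hG hFG

end ProductMeasure

section ThirdMoments

variable {α : Type*} [MeasurableSpace α] {μ : Measure α} {f g h : α → ℝ}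

lemma integrable_abs_pow_three (hf : MemLp f 3 μ) : Integrable (fun x => |f x| ^ 3) μ := by
  simpa using hf.integrable_norm_pow three_ne_zero

lemma memLp_three_of_eLpNorm_pow_three_le (hf : AEStronglyMeasurable f μ) {c : ℝ}
    (hc : eLpNorm f 3 μ ^ 3 ≤ ENNReal.ofReal c) : MemLp f 3 μ :=
  ⟨hf, ENNReal.pow_lt_top_iff.1 (hc.trans_lt ENNReal.ofReal_lt_top) |>.resolve_right three_ne_zero⟩

lemma integral_abs_pow_three_le_of_eLpNorm_pow_three_le (hf : AEStronglyMeasurable f μ) {c : ℝ}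
    (hc₀ : 0 ≤ c) (hc : eLpNorm f 3 μ ^ 3 ≤ ENNReal.ofReal c) : ∫ x, |f x| ^ 3 ∂μ ≤ c := by
  have hL := memLp_three_of_eLpNorm_pow_three_le hf hc
  rw [hL.eLpNorm_eq_integral_rpow_norm three_ne_zero ENNReal.ofNat_ne_top,
    ← ENNReal.ofReal_pow (by positivity), ENNReal.ofReal_le_ofReal_iff hc₀, ENNReal.toReal_ofNat,
    ← Real.rpow_natCast, ← Real.rpow_mul (by positivity)] at hc
  simpa using hc

lemma memLp_sq (hf : MemLp f 3 μ) : MemLp (fun x => f x ^ 2) (3 / 2) μ := by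
  simpa using hf.norm_rpow_div 2

lemma integrable_abs_mul_sq (hg : MemLp g 3 μ) (hh : MemLp h 3 μ) :
    Integrable (fun x => |g x| * h x ^ 2) μ := by
  have hpq : Real.HolderConjugate 3 (3 / 2) := ⟨by norm_num, by norm_num, by norm_num⟩
  have : ENNReal.HolderConjugate 3 (3 / 2) := by
    simpa [ENNReal.ofReal_div_of_pos] using hpq.ennrealOfReal
  exact hg.norm.integrable_mul (memLp_sq hh)

lemma integral_abs_mul_sq_le (hg : MemLp g 3 μ) (hh : MemLp h 3 μ) {A B : ℝ} (hA : 0 ≤ A)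
    (hB : 0 ≤ B) (hgA : ∫ x, |g x| ^ 3 ∂μ ≤ A ^ 3) (hhB : ∫ x, |h x| ^ 3 ∂μ ≤ B ^ 3) :
    ∫ x, |g x| * h x ^ 2 ∂μ ≤ A * B ^ 2 := by
  have hpq : Real.HolderConjugate 3 (3 / 2) := ⟨by norm_num, by norm_num, by norm_num⟩
  have hsq (x : α) : (h x ^ 2) ^ (3 / 2 : ℝ) = |h x| ^ 3 := by
    rw [← sq_abs, ← Real.rpow_natCast, ← Real.rpow_mul (abs_nonneg _), ← Real.rpow_natCast]
    norm_num
  calc ∫ x, |g x| * h x ^ 2 ∂μ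
      ≤ (∫ x, |g x| ^ (3 : ℝ) ∂μ) ^ (1 / 3 : ℝ) *
          (∫ x, (h x ^ 2) ^ (3 / 2 : ℝ) ∂μ) ^ (1 / (3 / 2) : ℝ) := by
        refine integral_mul_le_Lp_mul_Lq_of_nonneg hpq (ae_of_all _ fun x => abs_nonneg _)
          (ae_of_all _ fun x => sq_nonneg _) ?_ ?_
        · simpa using hg.norm
        · simpa [ENNReal.ofReal_div_of_pos] using memLp_sq hh
    _ ≤ (A ^ 3) ^ (1 / 3 : ℝ) * (B ^ 3) ^ (1 / (3 / 2) : ℝ) := by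
        simp only [hsq]
        gcongr
        · exact_mod_cast hgA
    _ = A * B ^ 2 := by
        rw [← Real.rpow_natCast A, ← Real.rpow_natCast B, ← Real.rpow_mul hA, ← Real.rpow_mul hB]
        norm_num

end ThirdMoments

section StandardMeasures

/-- A probability measure on `ℝ` of mean `0` and variance `1` whose third absolute moment is at
most `κ`: the law of one coordinate of an admissible random vector. -/
structure IsStandard (κ : ℝ) (μ : Measure ℝ) : Prop where
  isProbabilityMeasure : IsProbabilityMeasure μ
  memLp : MemLp id 3 μ
  mean : ∫ t, t ∂μ = 0
  second_moment : ∫ t, t ^ 2 ∂μ = 1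
  third_moment : ∫ t, |t| ^ 3 ∂μ ≤ κ

namespace IsStandard

variable {κ : ℝ} {μ : Measure ℝ}

lemma nonneg (h : IsStandard κ μ) : 0 ≤ κ :=
  (integral_nonneg fun _ => by positivity).trans h.third_moment

lemma memLp_add_mul (h : IsStandard κ μ) (a b : ℝ) : MemLp (fun t => a + t * b) 3 μ :=
  have := h.isProbabilityMeasure
  (memLp_const a).add (h.memLp.mul_const b)

lemma integral_le_of_le_cubic (h : IsStandard κ μ) {ψ : ℝ → ℝ} (hψ : Integrable ψ μ)
    {p q r s : ℝ} (hs : 0 ≤ s) (hle : ∀ t, ψ t ≤ p + q * t + r * t ^ 2 + s * |t| ^ 3) :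
    ∫ t, ψ t ∂μ ≤ p + r + s * κ := by
  have := h.isProbabilityMeasure
  have h1 : Integrable (fun t : ℝ => t) μ := h.memLp.integrable (by norm_num)
  have h2 : Integrable (fun t : ℝ => t ^ 2) μ :=
    (h.memLp.mono_exponent (by norm_num : (2 : ℝ≥0∞) ≤ 3)).integrable_sq
  have h3 : Integrable (fun t : ℝ => |t| ^ 3) μ := integrable_abs_pow_three h.memLp
  have h01 : Integrable (fun t : ℝ => p + q * t) μ := (integrable_const p).add (h1.const_mul q)
  have h012 : Integrable (fun t : ℝ => p + q * t + r * t ^ 2) μ := h01.add (h2.const_mul r)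
  calc ∫ t, ψ t ∂μ ≤ ∫ t, (p + q * t + r * t ^ 2 + s * |t| ^ 3) ∂μ :=
        integral_mono hψ (h012.add (h3.const_mul s)) hle
    _ = p + r + s * ∫ t, |t| ^ 3 ∂μ := by
        rw [integral_add h012 (h3.const_mul s), integral_add h01 (h2.const_mul r),
          integral_add (integrable_const p) (h1.const_mul q), integral_const_mul,
          integral_const_mul, integral_const_mul, h.mean, h.second_moment]
        simp
    _ ≤ p + r + s * κ := by gcongr; exact h.third_moment

end IsStandard

lemma abs_add_pow_three_le (a t : ℝ) :
    |a + t| ^ 3 ≤ |a| ^ 3 + 3 * (a * |a|) * t + 3 * |a| * t ^ 2 + |t| ^ 3 := by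
  wlog ha : 0 ≤ a generalizing a t
  · have := this (-a) (-t) (by linarith)
    rw [← neg_add] at this
    simpa only [abs_neg, neg_mul, mul_neg, neg_neg, neg_sq] using this
  rw [abs_of_nonneg ha]
  rcases abs_cases t with ⟨ht, _⟩ | ⟨ht, _⟩ <;>
    rcases abs_cases (a + t) with ⟨hat, _⟩ | ⟨hat, _⟩ <;>
    rw [ht, hat] <;>
    nlinarith [mul_nonneg ha (sq_nonneg (2 * a + 3 * t)), mul_nonneg ha (sq_nonneg t),
      mul_nonneg ha (sq_nonneg a)]

lemma IsStandard.integral_abs_add_mul_pow_three_le {κ : ℝ} {μ : Measure ℝ} (h : IsStandard κ μ)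
    (a b : ℝ) : ∫ t, |a + t * b| ^ 3 ∂μ ≤ |a| ^ 3 + 3 * |a| * b ^ 2 + κ * |b| ^ 3 := by
  rw [mul_comm κ]
  refine h.integral_le_of_le_cubic (integrable_abs_pow_three (h.memLp_add_mul a b))
    (q := 3 * (a * |a|) * b) (by positivity) fun t => ?_
  refine (abs_add_pow_three_le a (t * b)).trans_eq ?_
  rw [abs_mul]
  ring

/-- The law of a uniform random sign. -/
noncomputable def rademacher : Measure ℝ :=
  (2⁻¹ : ℝ≥0∞) • Measure.dirac 1 + (2⁻¹ : ℝ≥0∞) • Measure.dirac (-1)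

instance : IsProbabilityMeasure rademacher :=
  ⟨by simp [rademacher, ENNReal.inv_two_add_inv_two]⟩

lemma integral_rademacher {E : Type*} [NormedAddCommGroup E] [NormedSpace ℝ E] [CompleteSpace E]
    (F : ℝ → E) : ∫ t, F t ∂rademacher = (2⁻¹ : ℝ) • (F 1 + F (-1)) := by
  have hF (c : ℝ) : Integrable F ((2⁻¹ : ℝ≥0∞) • Measure.dirac c) :=
    (integrable_dirac (by simp)).smul_measure (by simp)
  rw [rademacher, integral_add_measure (hF 1) (hF (-1)), integral_smul_measure,
    integral_smul_measure, integral_dirac, integral_dirac, ← smul_add]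
  simp

lemma isStandard_rademacher : IsStandard 1 rademacher where
  isProbabilityMeasure := inferInstance
  memLp := memLp_of_bounded (a := -1) (b := 1) (by simp [rademacher]) aestronglyMeasurable_id 3
  mean := by simp [integral_rademacher]
  second_moment := by rw [integral_rademacher]; norm_num
  third_moment := by rw [integral_rademacher]; norm_num

lemma abs_pow_three_add_le_integral_rademacher (a b : ℝ) :
    |a| ^ 3 + 3 * |a| * b ^ 2 ≤ ∫ t, |a + t * b| ^ 3 ∂rademacher := by
  have hsum : |a| ^ 3 + 3 * |a| * b ^ 2 = |(a + b) ^ 3 + (a - b) ^ 3| / 2 := by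
    rw [show (a + b) ^ 3 + (a - b) ^ 3 = 2 * (a * (a ^ 2 + 3 * b ^ 2)) by ring, abs_mul, abs_mul,
      abs_of_nonneg (by positivity : 0 ≤ a ^ 2 + 3 * b ^ 2), abs_two, ← sq_abs a]
    ring
  rw [hsum, integral_rademacher, one_mul, neg_one_mul, ← sub_eq_add_neg, ← abs_pow, ← abs_pow,
    smul_eq_mul]
  linarith [abs_add_le ((a + b) ^ 3) ((a - b) ^ 3)]

lemma IsStandard.integral_abs_add_mul_pow_three_sub_le {κ : ℝ} {μ : Measure ℝ}
    (h : IsStandard κ μ) (a b : ℝ) :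
    ∫ t, |a + t * b| ^ 3 ∂μ - ∫ t, |a + t * b| ^ 3 ∂rademacher ≤ κ * |b| ^ 3 := by
  linarith [h.integral_abs_add_mul_pow_three_le a b, abs_pow_three_add_le_integral_rademacher a b]

section Families

variable {ι : Type*} [DecidableEq ι] {κ : ι → ℝ} {μ : ι → Measure ℝ}

lemma isStandard_update (h : ∀ i, IsStandard (κ i) (μ i)) (i : ι) {c : ℝ} {ν : Measure ℝ}
    (hν : IsStandard c ν) (j : ι) :
    IsStandard (update κ i c j) (update μ i ν j) := by
  rcases eq_or_ne j i with rfl | hj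
  · simpa only [update_self] using hν
  · simpa only [update_of_ne hj] using h j

lemma isStandard_piecewise {κ' : ι → ℝ} {μ' : ι → Measure ℝ} (h : ∀ i, IsStandard (κ i) (μ i))
    (h' : ∀ i, IsStandard (κ' i) (μ' i)) (s : Finset ι) (i : ι) :
    IsStandard (s.piecewise κ κ' i) (s.piecewise μ μ' i) := by
  by_cases hi : i ∈ s
  · simpa only [piecewise_eq_of_mem _ _ _ hi] using h i
  · simpa only [piecewise_eq_of_notMem _ _ _ hi] using h' i

end Families

end StandardMeasures

section ThirdMomentComparison

variable {ι : Type*} [Fintype ι]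

lemma memLp_prod_pi {p : ℝ≥0∞} (hp₀ : p ≠ 0) (hp : p ≠ ∞) {μ : ι → Measure ℝ}
    [∀ i, IsProbabilityMeasure (μ i)] (h : ∀ i, MemLp id p (μ i)) (J : Finset ι) :
    MemLp (fun x : ι → ℝ => ∏ i ∈ J, x i) p (Measure.pi μ) := by
  classical
  have hrpow (x : ι → ℝ) :
      ‖∏ i ∈ J, x i‖ ^ p.toReal = ∏ i, if i ∈ J then ‖x i‖ ^ p.toReal else 1 := by
    rw [norm_prod, ← Real.finsetProd_rpow _ _ fun i _ => norm_nonneg _, prod_ite_mem, univ_inter]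
  rw [← integrable_norm_rpow_iff (by fun_prop) hp₀ hp]
  simp only [hrpow]
  refine Integrable.fintype_prod (f := fun i t => if i ∈ J then ‖t‖ ^ p.toReal else 1) fun i => ?_
  split_ifs
  · exact (h i).integrable_norm_rpow hp₀ hp
  · exact integrable_const 1

lemma memLp_multilinearEval {p : ℝ≥0∞} (hp₀ : p ≠ 0) (hp : p ≠ ∞) {μ : ι → Measure ℝ}
    [∀ i, IsProbabilityMeasure (μ i)] (h : ∀ i, MemLp id p (μ i)) (a : Finset ι → ℝ) :
    MemLp (multilinearEval a) p (Measure.pi μ) :=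
  memLp_finsetSum _ fun J _ => (memLp_prod_pi hp₀ hp h J).const_mul (a J)

variable {κ : ι → ℝ} {μ : ι → Measure ℝ}

lemma IsStandard.memLp_multilinearEval (h : ∀ i, IsStandard (κ i) (μ i)) (a : Finset ι → ℝ) :
    MemLp (multilinearEval a) 3 (Measure.pi μ) :=
  have := fun i => (h i).isProbabilityMeasure
  Invariance.memLp_multilinearEval three_ne_zero ENNReal.ofNat_ne_top (fun i => (h i).memLp) a

variable [DecidableEq ι]

lemma IsStandard.integral_abs_pow_three_update_sub_le (h : ∀ i, IsStandard (κ i) (μ i)) (i : ι)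
    {c : ℝ} {ν : Measure ℝ} (hν : IsStandard c ν) (a : Finset ι → ℝ) :
    ∫ x, |multilinearEval a x| ^ 3 ∂Measure.pi (update μ i ν) -
        ∫ x, |multilinearEval a x| ^ 3 ∂Measure.pi (update μ i rademacher) ≤
      c * ∫ x, |multilinearEval (derivOn {i} a) x| ^ 3 ∂Measure.pi μ := by
  have := fun i => (h i).isProbabilityMeasure
  have := hν.isProbabilityMeasure
  have hint {c' : ℝ} {ν' : Measure ℝ} (hν' : IsStandard c' ν') :
      Integrable (fun x => |multilinearEval a x| ^ 3) (Measure.pi (update μ i ν')) :=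
    integrable_abs_pow_three (IsStandard.memLp_multilinearEval (isStandard_update h i hν') a)
  rw [← integral_const_mul]
  refine integral_pi_update_sub_le (hint hν) (hint isStandard_rademacher)
    ((integrable_abs_pow_three (IsStandard.memLp_multilinearEval h _)).const_mul c) fun x => ?_
  simp only [multilinearEval_update]
  exact hν.integral_abs_add_mul_pow_three_sub_le _ _

lemma IsStandard.integral_abs_pow_three_piecewise_le (h : ∀ i, IsStandard (κ i) (μ i))
    (s : Finset ι) (a : Finset ι → ℝ) :
    ∫ x, |multilinearEval a x| ^ 3 ∂Measure.pi (s.piecewise μ fun _ => rademacher) ≤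
      ∑ S ∈ s.powerset, (∏ i ∈ S, κ i) *
        ∫ x, |multilinearEval (derivOn S a) x| ^ 3 ∂Measure.pi fun _ => rademacher := by
  induction s using Finset.induction_on generalizing a with
  | empty => simp [derivOn_empty]
  | insert i s hi ih =>
    have hswap := IsStandard.integral_abs_pow_three_update_sub_le
      (isStandard_piecewise h (fun _ => isStandard_rademacher) s) i (h i) a
    have hself : update (s.piecewise μ fun _ => rademacher) i rademacher =
        s.piecewise μ fun _ => rademacher := by
      rw [update_eq_self_iff, piecewise_eq_of_notMem _ _ _ hi]
    set P : Measure (ι → ℝ) := Measure.pi fun _ => rademacher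
    have hderiv : κ i * ∑ S ∈ s.powerset, (∏ j ∈ S, κ j) *
          ∫ x, |multilinearEval (derivOn S (derivOn {i} a)) x| ^ 3 ∂P =
        ∑ S ∈ s.powerset, (∏ j ∈ insert i S, κ j) *
          ∫ x, |multilinearEval (derivOn (insert i S) a) x| ^ 3 ∂P := by
      rw [mul_sum]
      refine sum_congr rfl fun S hS => ?_
      have hiS : i ∉ S := notMem_mono (mem_powerset.1 hS) hi
      rw [prod_insert hiS, derivOn_derivOn_singleton_of_notMem a hiS, mul_assoc]
    rw [hself, ← piecewise_insert] at hswap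
    rw [sum_powerset_insert hi, ← hderiv]
    have := mul_le_mul_of_nonneg_left (ih (derivOn {i} a)) (h i).nonneg
    linarith [ih a]

end ThirdMomentComparison

section Hypercontractivity

lemma cube_add_le_cube_of_sq_eq {A B C : ℝ} (hA : 0 ≤ A) (hB : 0 ≤ B) (hC : 0 ≤ C)
    (h : C ^ 2 = A ^ 2 + 3 * B ^ 2) : A ^ 3 + 3 * (A * B ^ 2) + B ^ 3 ≤ C ^ 3 := by
  have hAC : A ≤ C := by nlinarith
  have hBC : B ≤ C := by nlinarith
  have hB2 : 3 * B ^ 2 ≤ (C - A) * (2 * C) := by nlinarith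
  have hB3 : B ^ 2 * B ≤ B ^ 2 * C := by gcongr
  nlinarith [mul_le_mul_of_nonneg_right hB2 hC, mul_nonneg (sq_nonneg B) hC]

variable {ι : Type*}

lemma dropVar_eq_zero [DecidableEq ι] {R : Type*} [Zero R] {a : Finset ι → R} {i : ι} {s : Finset ι}
    (ha : ∀ J, ¬J ⊆ insert i s → a J = 0) {J : Finset ι} (hJ : ¬J ⊆ s) : dropVar i a J = 0 := by
  by_cases hi : i ∈ J
  · exact if_pos hi
  · rw [dropVar_of_notMem a hi]
    exact ha J fun h => hJ ((subset_insert_iff_of_notMem hi).1 h)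

lemma derivOn_singleton_eq_zero [DecidableEq ι] {R : Type*} [Zero R] {a : Finset ι → R} {i : ι}
    {s : Finset ι} (ha : ∀ J, ¬J ⊆ insert i s → a J = 0) {J : Finset ι} (hJ : ¬J ⊆ s) :
    derivOn {i} a J = 0 := by
  by_cases hi : i ∈ J
  · simp [derivOn, hi]
  · rw [derivOn_singleton_of_notMem a hi]
    exact ha _ fun h => hJ ((subset_insert_iff_of_notMem hi).1 ((subset_insert i J).trans h))

variable [Fintype ι]

lemma integral_abs_pow_three_rademacher_le_of_dropVar_of_derivOn [DecidableEq ι]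
    (a : Finset ι → ℝ) (i : ι)
    (hdrop : ∫ x, |multilinearEval (dropVar i a) x| ^ 3 ∂Measure.pi (fun _ => rademacher) ≤
      weightedNorm (dropVar i a) ^ 3)
    (hderiv : ∫ x, |multilinearEval (derivOn {i} a) x| ^ 3 ∂Measure.pi (fun _ => rademacher) ≤
      weightedNorm (derivOn {i} a) ^ 3) :
    ∫ x, |multilinearEval a x| ^ 3 ∂Measure.pi (fun _ => rademacher) ≤ weightedNorm a ^ 3 := by
  set P : Measure (ι → ℝ) := Measure.pi fun _ => rademacher
  set A := weightedNorm (dropVar i a)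
  set B := weightedNorm (derivOn {i} a)
  have hL (b : Finset ι → ℝ) : MemLp (multilinearEval b) 3 P :=
    IsStandard.memLp_multilinearEval (fun _ => isStandard_rademacher) b
  have hself : update (fun _ : ι => rademacher) i rademacher = fun _ => rademacher :=
    update_eq_self i _
  have hint : Integrable (fun x => |multilinearEval a x| ^ 3)
      (Measure.pi (update (fun _ => rademacher) i rademacher)) :=
    hself.symm ▸ integrable_abs_pow_three (hL a)
  have hg3 := integrable_abs_pow_three (hL (dropVar i a))
  have hh3 := integrable_abs_pow_three (hL (derivOn {i} a))
  have hgh := (integrable_abs_mul_sq (hL (dropVar i a)) (hL (derivOn {i} a))).const_mul 3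
  calc ∫ x, |multilinearEval a x| ^ 3 ∂P
      = ∫ x, ∫ t, |multilinearEval (dropVar i a) x + t * multilinearEval (derivOn {i} a) x| ^ 3
          ∂rademacher ∂P := by
        simp only [← multilinearEval_update]
        rw [← integral_pi_update hint, hself]
    _ ≤ ∫ x, (|multilinearEval (dropVar i a) x| ^ 3 +
          3 * (|multilinearEval (dropVar i a) x| * multilinearEval (derivOn {i} a) x ^ 2) +
          |multilinearEval (derivOn {i} a) x| ^ 3) ∂P := by
        refine integral_mono ?_ ((hg3.add hgh).add hh3) fun x => ?_
        · simpa only [multilinearEval_update] using integrable_integral_update hint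
        · simpa only [one_mul, mul_assoc] using
            isStandard_rademacher.integral_abs_add_mul_pow_three_le _ _
    _ ≤ A ^ 3 + 3 * (A * B ^ 2) + B ^ 3 := by
        rw [integral_add (by fun_prop) hh3, integral_add hg3 hgh, integral_const_mul]
        gcongr
        exact integral_abs_mul_sq_le (hL _) (hL _) (weightedNorm_nonneg _) (weightedNorm_nonneg _)
          hdrop hderiv
    _ ≤ weightedNorm a ^ 3 :=
        cube_add_le_cube_of_sq_eq (weightedNorm_nonneg _) (weightedNorm_nonneg _)
          (weightedNorm_nonneg _) (sq_weightedNorm_eq_add i a)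

lemma integral_abs_pow_three_rademacher_le_of_support_subset (s : Finset ι) {a : Finset ι → ℝ}
    (ha : ∀ J, ¬J ⊆ s → a J = 0) :
    ∫ x, |multilinearEval a x| ^ 3 ∂Measure.pi (fun _ => rademacher) ≤ weightedNorm a ^ 3 := by
  classical
  induction s using Finset.induction_on generalizing a with
  | empty =>
    have ha' : ∀ J, J ≠ ∅ → a J = 0 := fun J hJ => ha J (mt subset_empty.1 hJ)
    have heval (x : ι → ℝ) : multilinearEval a x = a ∅ := by
      rw [multilinearEval, Fintype.sum_eq_single ∅ fun J hJ => by rw [ha' J hJ, zero_mul],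
        prod_empty, mul_one]
    have hnorm : weightedNorm a = |a ∅| := by
      rw [weightedNorm, Fintype.sum_eq_single ∅ fun J hJ => by rw [ha' J hJ]; simp,
        card_empty, pow_zero, one_mul, Real.sqrt_sq_eq_abs]
    simp [heval, hnorm]
  | insert i s _ ih =>
    exact integral_abs_pow_three_rademacher_le_of_dropVar_of_derivOn a i
      (ih fun J => dropVar_eq_zero ha) (ih fun J => derivOn_singleton_eq_zero ha)

theorem integral_abs_pow_three_rademacher_le (a : Finset ι → ℝ) :
    ∫ x, |multilinearEval a x| ^ 3 ∂Measure.pi (fun _ => rademacher) ≤ weightedNorm a ^ 3 :=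
  integral_abs_pow_three_rademacher_le_of_support_subset univ fun J hJ =>
    absurd (subset_univ J) hJ

variable [DecidableEq ι] {κ : ι → ℝ} {μ : ι → Measure ℝ}

theorem IsStandard.integral_abs_pow_three_le (h : ∀ i, IsStandard (κ i) (μ i))
    (a : Finset ι → ℝ) : ∫ x, |multilinearEval a x| ^ 3 ∂Measure.pi μ ≤
      ∑ S, (∏ i ∈ S, κ i) * weightedNorm (derivOn S a) ^ 3 := by
  have hcompare := integral_abs_pow_three_piecewise_le h univ a
  rw [piecewise_univ, powerset_univ] at hcompare
  refine hcompare.trans (sum_le_sum fun S _ => ?_)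
  have hκ : 0 ≤ ∏ i ∈ S, κ i := prod_nonneg fun i _ => (h i).nonneg
  gcongr
  exact integral_abs_pow_three_rademacher_le _

lemma IsStandard.mul_integral_abs_derivOn_pow_three_le (h : ∀ i, IsStandard (κ i) (μ i))
    (a : Finset ι → ℝ) (i : ι) :
    κ i * ∫ x, |multilinearEval (derivOn {i} a) x| ^ 3 ∂Measure.pi μ ≤
      ∑ S with i ∈ S, (∏ j ∈ S, κ j) * weightedNorm (derivOn S a) ^ 3 := by
  calc κ i * ∫ x, |multilinearEval (derivOn {i} a) x| ^ 3 ∂Measure.pi μ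
      ≤ κ i * ∑ S, (∏ j ∈ S, κ j) * weightedNorm (derivOn S (derivOn {i} a)) ^ 3 :=
        mul_le_mul_of_nonneg_left (integral_abs_pow_three_le h _) (h i).nonneg
    _ = ∑ S ∈ (univ.erase i).powerset,
          (∏ j ∈ insert i S, κ j) * weightedNorm (derivOn (insert i S) a) ^ 3 := by
        rw [sum_eq_sum_powerset_erase i, mul_sum]
        refine sum_congr rfl fun S hS => ?_
        have hi : i ∉ S := notMem_of_mem_powerset_erase hS
        rw [derivOn_derivOn_singleton_of_notMem a hi,
          derivOn_derivOn_singleton_of_mem a (mem_insert_self i S), weightedNorm_zero,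
          prod_insert hi]
        ring
    _ = ∑ S with i ∈ S, (∏ j ∈ S, κ j) * weightedNorm (derivOn S a) ^ 3 := by
        rw [sum_filter, sum_eq_sum_powerset_erase i]
        refine sum_congr rfl fun S hS => ?_
        rw [if_neg (notMem_of_mem_powerset_erase hS), if_pos (mem_insert_self i S), zero_add]

end Hypercontractivity

section Taylor

variable {n : ℕ} {φ : ℝ → ℝ} {M : ℝ}

lemma abs_sub_taylor_le (hφ : ContDiff ℝ (n + 1) φ) (hM : ∀ x, |iteratedDeriv (n + 1) φ x| ≤ M)
    (a u : ℝ) :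
    |φ (a + u) - ∑ k ∈ range (n + 1), iteratedDeriv k φ a / k.factorial * u ^ k| ≤
      M / (n + 1).factorial * |u| ^ (n + 1) := by
  rcases eq_or_ne u 0 with rfl | hu
  · simp [sum_range_succ']
  have hne : a ≠ a + u := by simpa using hu
  obtain ⟨y, -, hy⟩ := taylor_mean_remainder_lagrange_iteratedDeriv hne hφ.contDiffOn
  have hpoly : taylorWithinEval φ n (Set.uIcc a (a + u)) a (a + u) =
      ∑ k ∈ range (n + 1), iteratedDeriv k φ a / k.factorial * u ^ k := by
    rw [taylor_within_apply]
    refine sum_congr rfl fun k hk => ?_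
    have hkn : (k : WithTop ℕ∞) ≤ n + 1 := by exact_mod_cast (mem_range.1 hk).le
    rw [iteratedDerivWithin_eq_iteratedDeriv (uniqueDiffOn_uIcc hne) (hφ.of_le hkn).contDiffAt
      Set.left_mem_uIcc, add_sub_cancel_left, smul_eq_mul]
    ring
  rw [← hpoly, hy, add_sub_cancel_left, abs_div, abs_mul, abs_pow, Nat.abs_cast, mul_div_right_comm]
  gcongr
  exact hM y

lemma integrable_comp_of_memLp {α : Type*} [MeasurableSpace α] {μ : Measure α} [IsFiniteMeasure μ]
    (hφ : ContDiff ℝ (n + 1) φ) (hM : ∀ x, |iteratedDeriv (n + 1) φ x| ≤ M) {F : α → ℝ}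
    (hF : MemLp F (n + 1 : ℕ) μ) : Integrable (fun x => φ (F x)) μ := by
  set T : ℝ → ℝ := fun u => ∑ k ∈ range (n + 1), iteratedDeriv k φ 0 / k.factorial * u ^ k
  have hpow (k : ℕ) (hk : k ≤ n + 1) : Integrable (fun x => F x ^ k) μ := by
    have hFk : MemLp F k μ := hF.mono_exponent (mod_cast hk)
    exact hFk.integrable_norm_pow'.mono' (hF.aestronglyMeasurable.pow k)
      (ae_of_all _ fun x => (norm_pow _ _).le)
  have hT : Integrable (fun x => T (F x)) μ :=
    integrable_finsetSum _ fun k hk => (hpow k (mem_range.1 hk).le).const_mul _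
  have hrem : Integrable (fun x => φ (F x) - T (F x)) μ := by
    refine ((hpow (n + 1) le_rfl).norm.const_mul (M / (n + 1).factorial)).mono'
      ((hφ.continuous.comp_aestronglyMeasurable hF.aestronglyMeasurable).sub
        hT.aestronglyMeasurable) (ae_of_all _ fun x => ?_)
    simpa using abs_sub_taylor_le hφ hM 0 (F x)
  exact (hrem.add hT).congr (ae_of_all _ fun x => sub_add_cancel _ _)

end Taylor

section Lindeberg

variable {φ : ℝ → ℝ} {M : ℝ}

lemma IsStandard.abs_integral_comp_sub_le {κ : ℝ} {μ : Measure ℝ} (h : IsStandard κ μ)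
    (hφ : ContDiff ℝ 3 φ) (hM : ∀ x, |iteratedDeriv 3 φ x| ≤ M) (a b : ℝ) :
    |∫ t, φ (a + t * b) ∂μ - (φ a + iteratedDeriv 2 φ a / 2 * b ^ 2)| ≤ M / 6 * |b| ^ 3 * κ := by
  have := h.isProbabilityMeasure
  have hM₀ : 0 ≤ M := (abs_nonneg _).trans (hM 0)
  have hint : Integrable (fun t => φ (a + t * b)) μ :=
    integrable_comp_of_memLp (n := 2) hφ hM (h.memLp_add_mul a b)
  have htaylor (t : ℝ) : |φ (a + t * b) - (φ a + iteratedDeriv 1 φ a * b * t +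
      iteratedDeriv 2 φ a / 2 * b ^ 2 * t ^ 2)| ≤ M / 6 * |b| ^ 3 * |t| ^ 3 := by
    convert abs_sub_taylor_le (n := 2) hφ hM a (t * b) using 1
    · simp only [sum_range_succ, sum_range_zero, iteratedDeriv_zero, Nat.factorial]
      congr 1
      push_cast
      ring
    · rw [abs_mul]
      norm_num [Nat.factorial]
      ring
  have hupper := h.integral_le_of_le_cubic hint (by positivity : 0 ≤ M / 6 * |b| ^ 3)
    (p := φ a) (q := iteratedDeriv 1 φ a * b) (r := iteratedDeriv 2 φ a / 2 * b ^ 2)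
    fun t => by linarith [(abs_le.1 (htaylor t)).2]
  have hlower := h.integral_le_of_le_cubic hint.neg (by positivity : 0 ≤ M / 6 * |b| ^ 3)
    (p := -φ a) (q := -(iteratedDeriv 1 φ a * b)) (r := -(iteratedDeriv 2 φ a / 2 * b ^ 2))
    fun t => by simp only [Pi.neg_apply]; linarith [(abs_le.1 (htaylor t)).1]
  simp only [Pi.neg_apply, integral_neg] at hlower
  exact abs_le.2 ⟨by linarith, by linarith⟩

lemma IsStandard.integral_comp_sub_le {κ : ℝ} {μ ν : Measure ℝ} (hμ : IsStandard κ μ)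
    (hν : IsStandard κ ν) (hφ : ContDiff ℝ 3 φ) (hM : ∀ x, |iteratedDeriv 3 φ x| ≤ M) (a b : ℝ) :
    ∫ t, φ (a + t * b) ∂μ - ∫ t, φ (a + t * b) ∂ν ≤ M / 3 * κ * |b| ^ 3 := by
  have hμ' := (abs_le.1 (hμ.abs_integral_comp_sub_le hφ hM a b)).2
  have hν' := (abs_le.1 (hν.abs_integral_comp_sub_le hφ hM a b)).1
  linarith

variable {ι : Type*} [Fintype ι] {κ : ι → ℝ}

lemma IsStandard.integrable_comp_multilinearEval {μ : ι → Measure ℝ}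
    (h : ∀ i, IsStandard (κ i) (μ i)) (hφ : ContDiff ℝ 3 φ) (hM : ∀ x, |iteratedDeriv 3 φ x| ≤ M)
    (a : Finset ι → ℝ) : Integrable (fun x => φ (multilinearEval a x)) (Measure.pi μ) :=
  have := fun i => (h i).isProbabilityMeasure
  integrable_comp_of_memLp (n := 2) hφ hM (IsStandard.memLp_multilinearEval h a)

variable [DecidableEq ι]

lemma IsStandard.integral_pi_update_sub_le {ρ : ι → Measure ℝ} (h : ∀ i, IsStandard (κ i) (ρ i))
    (i : ι) {c : ℝ} {μ ν : Measure ℝ} (hμ : IsStandard c μ) (hν : IsStandard c ν)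
    (hφ : ContDiff ℝ 3 φ) (hM : ∀ x, |iteratedDeriv 3 φ x| ≤ M) (a : Finset ι → ℝ) :
    ∫ x, φ (multilinearEval a x) ∂Measure.pi (update ρ i μ) -
        ∫ x, φ (multilinearEval a x) ∂Measure.pi (update ρ i ν) ≤
      M / 3 * c * ∫ x, |multilinearEval (derivOn {i} a) x| ^ 3 ∂Measure.pi ρ := by
  have := fun i => (h i).isProbabilityMeasure
  have := hμ.isProbabilityMeasure
  have := hν.isProbabilityMeasure
  rw [← integral_const_mul]
  refine Invariance.integral_pi_update_sub_le
    (integrable_comp_multilinearEval (isStandard_update h i hμ) hφ hM a)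
    (integrable_comp_multilinearEval (isStandard_update h i hν) hφ hM a)
    ((integrable_abs_pow_three (IsStandard.memLp_multilinearEval h _)).const_mul _) fun x => ?_
  simp only [multilinearEval_update]
  exact hμ.integral_comp_sub_le hν hφ hM _ _

variable {μ ν : ι → Measure ℝ}

lemma integral_pi_piecewise_sub_le (hμ : ∀ i, IsStandard (κ i) (μ i))
    (hν : ∀ i, IsStandard (κ i) (ν i)) (hφ : ContDiff ℝ 3 φ) (hM : ∀ x, |iteratedDeriv 3 φ x| ≤ M)
    (a : Finset ι → ℝ) (s : Finset ι) :
    ∫ x, φ (multilinearEval a x) ∂Measure.pi (s.piecewise μ ν) -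
        ∫ x, φ (multilinearEval a x) ∂Measure.pi ν ≤
      ∑ i ∈ s, M / 3 * ∑ S with i ∈ S, (∏ j ∈ S, κ j) * weightedNorm (derivOn S a) ^ 3 := by
  have hM₀ : 0 ≤ M := (abs_nonneg _).trans (hM 0)
  induction s using Finset.induction_on with
  | empty => simp
  | insert i s hi ih =>
    have hρ (j : ι) : IsStandard (κ j) (s.piecewise μ ν j) := by
      simpa only [piecewise_idem_left, piecewise_same] using isStandard_piecewise hμ hν s j
    have hself : update (s.piecewise μ ν) i (ν i) = s.piecewise μ ν := by
      rw [update_eq_self_iff, piecewise_eq_of_notMem _ _ _ hi]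
    have hswap := IsStandard.integral_pi_update_sub_le hρ i (hμ i) (hν i) hφ hM a
    rw [hself, ← piecewise_insert, mul_assoc] at hswap
    have hderiv := mul_le_mul_of_nonneg_left
      (IsStandard.mul_integral_abs_derivOn_pow_three_le hρ a i) (by positivity : 0 ≤ M / 3)
    rw [sum_insert hi]
    linarith

theorem abs_integral_pi_sub_le (hμ : ∀ i, IsStandard (κ i) (μ i))
    (hν : ∀ i, IsStandard (κ i) (ν i)) (hφ : ContDiff ℝ 3 φ) (hM : ∀ x, |iteratedDeriv 3 φ x| ≤ M)
    (a : Finset ι → ℝ) :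
    |∫ x, φ (multilinearEval a x) ∂Measure.pi μ - ∫ x, φ (multilinearEval a x) ∂Measure.pi ν| ≤
      M / 3 * ∑ S, #S * ((∏ i ∈ S, κ i) * weightedNorm (derivOn S a) ^ 3) := by
  have hcard (w : Finset ι → ℝ) : ∑ i, ∑ S with i ∈ S, w S = ∑ S, #S * w S := by
    simp only [sum_filter]
    rw [sum_comm]
    simp
  rw [← hcard, mul_sum, abs_sub_le_iff]
  have hμν := integral_pi_piecewise_sub_le hμ hν hφ hM a univ
  have hνμ := integral_pi_piecewise_sub_le hν hμ hφ hM a univ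
  rw [piecewise_univ] at hμν hνμ
  exact ⟨hμν, hνμ⟩

end Lindeberg

section Influences

variable {ι : Type*} [Fintype ι] [DecidableEq ι]

/-- `W_S` for the multilinear polynomial with coefficient function `a`: the sum of the squared
coefficients of all multiples of `v_S`. -/
def coeffUpWeight (a : Finset ι → ℝ) (S : Finset ι) : ℝ :=
  ∑ J with S ⊆ J, a J ^ 2

lemma coeffUpWeight_nonneg (a : Finset ι → ℝ) (S : Finset ι) : 0 ≤ coeffUpWeight a S :=
  sum_nonneg fun _ _ => sq_nonneg _

lemma sq_weightedNorm_derivOn (a : Finset ι → ℝ) (S : Finset ι) :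
    weightedNorm (derivOn S a) ^ 2 = ∑ J with S ⊆ J, 3 ^ #(J \ S) * a J ^ 2 := by
  rw [sq_weightedNorm, ← sum_filter_of_ne (p := Disjoint S)]
  · refine sum_nbij' (S ∪ ·) (· \ S) (by simp) (by simp [disjoint_sdiff])
      (fun J hJ => union_sdiff_cancel_left (mem_filter.1 hJ).2)
      (fun J hJ => union_sdiff_of_subset (mem_filter.1 hJ).2) fun J hJ => ?_
    have hSJ := (mem_filter.1 hJ).2
    rw [derivOn, if_pos hSJ, union_sdiff_cancel_left hSJ]
  · intro J _ hJ
    contrapose! hJ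
    simp [derivOn, hJ]

variable {d : ℕ} {a : Finset ι → ℝ}

lemma weightedNorm_derivOn_le (ha : ∀ J, d < #J → a J = 0) (S : Finset ι) :
    weightedNorm (derivOn S a) ≤ 2 ^ d * √(coeffUpWeight a S) := by
  refine le_of_pow_le_pow_left₀ two_ne_zero (by positivity) ?_
  rw [sq_weightedNorm_derivOn, mul_pow, Real.sq_sqrt (coeffUpWeight_nonneg a S), coeffUpWeight,
    mul_sum]
  refine sum_le_sum fun J _ => ?_
  rcases lt_or_ge d #J with hJ | hJ
  · simp [ha J hJ]
  gcongr
  calc (3 : ℝ) ^ #(J \ S) ≤ 3 ^ d := by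
        gcongr
        · norm_num
        · exact (card_le_card sdiff_subset).trans hJ
    _ ≤ 4 ^ d := by gcongr; norm_num
    _ = (2 ^ d) ^ 2 := by rw [← pow_mul, mul_comm, pow_mul]; norm_num

lemma card_mul_coeffUpWeight_le (ha : ∀ J, d < #J → a J = 0) (S : Finset ι) :
    #S * coeffUpWeight a S ≤ d * coeffUpWeight a S := by
  rw [coeffUpWeight, mul_sum, mul_sum]
  refine sum_le_sum fun J hJ => ?_
  rcases lt_or_ge d #J with hd | hd
  · simp [ha J hd]
  gcongr
  exact (card_le_card (mem_filter.1 hJ).2).trans hd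

lemma sum_coeffUpWeight_le (ha : ∀ J, d < #J → a J = 0) :
    ∑ S, coeffUpWeight a S ≤ 2 ^ d * coeffUpWeight a ∅ := by
  calc ∑ S, coeffUpWeight a S = ∑ J, 2 ^ #J * a J ^ 2 := by
        simp only [coeffUpWeight, sum_filter]
        rw [sum_comm]
        refine sum_congr rfl fun J _ => ?_
        rw [← sum_filter, filter_subset_univ, sum_const, card_powerset, nsmul_eq_mul, Nat.cast_pow,
          Nat.cast_ofNat]
    _ ≤ ∑ J, 2 ^ d * a J ^ 2 := by
        refine sum_le_sum fun J _ => ?_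
        rcases lt_or_ge d #J with hd | hd
        · simp [ha J hd]
        gcongr
        norm_num
    _ = 2 ^ d * coeffUpWeight a ∅ := by simp [coeffUpWeight, mul_sum]

variable {κ : ι → ℝ} {ε : ℝ}

lemma prod_mul_weightedNorm_derivOn_pow_three_le (hκ : ∀ i, 0 ≤ κ i)
    (ha : ∀ J, d < #J → a J = 0) {S : Finset ι} (hS : coeffUpWeight a S * ∏ i ∈ S, κ i ^ 2 ≤ ε) :
    (∏ i ∈ S, κ i) * weightedNorm (derivOn S a) ^ 3 ≤ 8 ^ d * √ε * coeffUpWeight a S := by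
  have hp : 0 ≤ ∏ i ∈ S, κ i := prod_nonneg fun i _ => hκ i
  have hW : √(coeffUpWeight a S) ^ 2 = coeffUpWeight a S := Real.sq_sqrt (coeffUpWeight_nonneg a S)
  have hinfluence : (∏ i ∈ S, κ i) * √(coeffUpWeight a S) ≤ √ε :=
    Real.le_sqrt_of_sq_le (by rwa [mul_pow, hW, ← prod_pow, mul_comm])
  calc (∏ i ∈ S, κ i) * weightedNorm (derivOn S a) ^ 3
      ≤ (∏ i ∈ S, κ i) * (2 ^ d * √(coeffUpWeight a S)) ^ 3 := by
        gcongr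
        · exact weightedNorm_nonneg _
        · exact weightedNorm_derivOn_le ha S
    _ = (2 ^ d) ^ 3 * ((∏ i ∈ S, κ i) * √(coeffUpWeight a S)) * √(coeffUpWeight a S) ^ 2 := by ring
    _ ≤ (2 ^ d) ^ 3 * √ε * √(coeffUpWeight a S) ^ 2 := by gcongr
    _ = 8 ^ d * √ε * coeffUpWeight a S := by
        rw [hW, ← pow_mul, mul_comm d, pow_mul]
        norm_num

lemma sum_card_mul_prod_mul_weightedNorm_derivOn_pow_three_le (hκ : ∀ i, 0 ≤ κ i)
    (ha : ∀ J, d < #J → a J = 0)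
    (hε : ∀ S : Finset ι, S.Nonempty → coeffUpWeight a S * ∏ i ∈ S, κ i ^ 2 ≤ ε) :
    ∑ S, #S * ((∏ i ∈ S, κ i) * weightedNorm (derivOn S a) ^ 3) ≤
      2 ^ (5 * d) * coeffUpWeight a ∅ * √ε := by
  have hd : (d : ℝ) ≤ 2 ^ d := by exact_mod_cast d.lt_two_pow_self.le
  calc ∑ S, #S * ((∏ i ∈ S, κ i) * weightedNorm (derivOn S a) ^ 3)
      ≤ ∑ S, #S * (8 ^ d * √ε * coeffUpWeight a S) := by
        refine sum_le_sum fun S _ => ?_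
        rcases S.eq_empty_or_nonempty with rfl | hS
        · simp
        exact mul_le_mul_of_nonneg_left
          (prod_mul_weightedNorm_derivOn_pow_three_le hκ ha (hε S hS)) (Nat.cast_nonneg _)
    _ = 8 ^ d * √ε * ∑ S, #S * coeffUpWeight a S := by
        rw [mul_sum]
        exact sum_congr rfl fun S _ => by ring
    _ ≤ 8 ^ d * √ε * ∑ S, d * coeffUpWeight a S :=
        mul_le_mul_of_nonneg_left (sum_le_sum fun S _ => card_mul_coeffUpWeight_le ha S)
          (by positivity)
    _ ≤ 8 ^ d * √ε * (2 ^ d * (2 ^ d * coeffUpWeight a ∅)) := by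
        rw [← mul_sum]
        exact mul_le_mul_of_nonneg_left (mul_le_mul hd (sum_coeffUpWeight_le ha)
          (sum_nonneg fun S _ => coeffUpWeight_nonneg a S) (by positivity)) (by positivity)
    _ = 2 ^ (5 * d) * coeffUpWeight a ∅ * √ε := by
        rw [pow_mul, show (2 : ℝ) ^ 5 = 8 * 2 * 2 by norm_num, mul_pow, mul_pow]
        ring

theorem abs_integral_pi_sub_le_of_influence_le {μ ν : ι → Measure ℝ}
    (hμ : ∀ i, IsStandard (κ i) (μ i)) (hν : ∀ i, IsStandard (κ i) (ν i)) {φ : ℝ → ℝ}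
    (hφ : ContDiff ℝ 3 φ) {M : ℝ} (hM : ∀ x, |iteratedDeriv 3 φ x| ≤ M)
    (ha : ∀ J, d < #J → a J = 0)
    (hε : ∀ S : Finset ι, S.Nonempty → coeffUpWeight a S * ∏ i ∈ S, κ i ^ 2 ≤ ε) :
    |∫ x, φ (multilinearEval a x) ∂Measure.pi μ - ∫ x, φ (multilinearEval a x) ∂Measure.pi ν| ≤
      2 ^ (5 * d) * M * coeffUpWeight a ∅ * √ε := by
  have hM₀ : 0 ≤ M := (abs_nonneg _).trans (hM 0)
  have hW := coeffUpWeight_nonneg a ∅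
  calc |∫ x, φ (multilinearEval a x) ∂Measure.pi μ - ∫ x, φ (multilinearEval a x) ∂Measure.pi ν|
      ≤ M / 3 * ∑ S, #S * ((∏ i ∈ S, κ i) * weightedNorm (derivOn S a) ^ 3) :=
        abs_integral_pi_sub_le hμ hν hφ hM a
    _ ≤ M / 3 * (2 ^ (5 * d) * coeffUpWeight a ∅ * √ε) :=
        mul_le_mul_of_nonneg_left (sum_card_mul_prod_mul_weightedNorm_derivOn_pow_three_le
          (fun i => (hμ i).nonneg) ha hε) (by positivity)
    _ ≤ M * (2 ^ (5 * d) * coeffUpWeight a ∅ * √ε) := by gcongr; linarith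
    _ = 2 ^ (5 * d) * M * coeffUpWeight a ∅ * √ε := by ring

end Influences

section MultilinearPolynomials

lemma sum_single_one_apply {ι : Type*} [DecidableEq ι] (J : Finset ι) (i : ι) :
    (∑ j ∈ J, Finsupp.single j 1 : ι →₀ ℕ) i = if i ∈ J then 1 else 0 := by
  simp [Finsupp.finsetSum_apply, Finsupp.single_apply]

lemma support_sum_single_one {ι : Type*} (J : Finset ι) :
    (∑ j ∈ J, Finsupp.single j 1 : ι →₀ ℕ).support = J := by
  classical
  ext i
  simp [sum_single_one_apply]

lemma sum_support_single_one {ι : Type*} {m : ι →₀ ℕ} (hm : ∀ i, m i ≤ 1) :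
    ∑ j ∈ m.support, Finsupp.single j 1 = m := by
  classical
  ext i
  rw [sum_single_one_apply]
  split_ifs with hi
  · exact (Nat.one_le_iff_ne_zero.2 (Finsupp.mem_support_iff.1 hi)).antisymm (hm i)
  · exact (Finsupp.notMem_support_iff.1 hi).symm

variable {n : ℕ} {f : MvPolynomial (Fin n) ℝ}

lemma monomialCoeff_eq_zero {d : ℕ} (hd : f.totalDegree ≤ d) {J : Finset (Fin n)} (hJ : d < #J) :
    monomialCoeff f J = 0 := by
  refine MvPolynomial.coeff_eq_zero_of_totalDegree_lt (hd.trans_lt ?_)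
  rw [← Finsupp.degree_apply, map_sum]
  simpa using hJ

lemma genInfluence_eq (σ : Fin n → ℝ) (f : MvPolynomial (Fin n) ℝ) (S : Finset (Fin n)) :
    genInfluence σ f S = coeffUpWeight (monomialCoeff f) S * ∏ i ∈ S, (σ i)⁻¹ ^ 2 := by
  simp only [genInfluence, upWeight, coeffUpWeight, inv_pow]

lemma IsMultilinear.eval_eq (hf : IsMultilinear f) (x : Fin n → ℝ) :
    MvPolynomial.eval x f = multilinearEval (monomialCoeff f) x := by
  have hle {m : Fin n →₀ ℕ} (hm : m ∈ f.support) (i : Fin n) : m i ≤ 1 :=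
    (MvPolynomial.monomial_le_degreeOf i hm).trans (hf i)
  rw [MvPolynomial.eval_eq, multilinearEval]
  refine sum_of_injOn Finsupp.support (fun m hm m' hm' h => ?_) (fun _ _ => mem_coe.2 (mem_univ _))
    (fun J _ hJ => ?_) fun m hm => ?_
  · rw [← sum_support_single_one (hle hm), h, sum_support_single_one (hle hm')]
  · rw [mul_eq_zero, monomialCoeff, ← MvPolynomial.notMem_support_iff]
    exact Or.inl fun hmem => hJ ⟨_, hmem, support_sum_single_one J⟩
  · rw [monomialCoeff, sum_support_single_one (hle hm)]
    congr 1
    refine prod_congr rfl fun i hi => ?_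
    rw [(hle hm i).antisymm (Nat.one_le_iff_ne_zero.2 (Finsupp.mem_support_iff.1 hi)), pow_one]

end MultilinearPolynomials

section Admissible

variable {n : ℕ} {Ω : Type*} [MeasurableSpace Ω] {P : Measure Ω} [IsProbabilityMeasure P]
  {σ : Fin n → ℝ} {X : Fin n → Ω → ℝ}

lemma IsAdmissible.isStandard_map (h : IsAdmissible P σ X) (hσ : ∀ i, 0 < σ i) (i : Fin n) :
    IsStandard (σ i)⁻¹ (P.map (X i)) := by
  have hX : AEMeasurable (X i) P := (h.measurable i).aemeasurable
  have hX' := hX.aestronglyMeasurable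
  constructor
  · exact Measure.isProbabilityMeasure_map hX
  · exact (memLp_map_measure_iff aestronglyMeasurable_id hX).2
      (memLp_three_of_eLpNorm_pow_three_le hX' (h.third_moment i))
  · rw [integral_map hX (by fun_prop)]
    exact h.mean i
  · rw [integral_map hX (by fun_prop), ← h.variance i, variance_eq_integral hX, h.mean i]
    simp only [sub_zero]
  · rw [integral_map hX (by fun_prop)]
    exact integral_abs_pow_three_le_of_eLpNorm_pow_three_le hX' (inv_pos.2 (hσ i)).le
      (h.third_moment i)

lemma IsAdmissible.measurePreserving (h : IsAdmissible P σ X) :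
    MeasurePreserving (fun ω i => X i ω) P (Measure.pi fun i => P.map (X i)) :=
  ⟨measurable_pi_lambda _ h.measurable,
    (iIndepFun_iff_map_fun_eq_pi_map fun i => (h.measurable i).aemeasurable).1 h.indep⟩

variable {f : MvPolynomial (Fin n) ℝ} {φ : ℝ → ℝ}

lemma IsAdmissible.integrable_comp_evalAt (h : IsAdmissible P σ X) (hσ : ∀ i, 0 < σ i)
    (hf : IsMultilinear f) (hφ : ContDiff ℝ 3 φ) {M : ℝ} (hM : ∀ x, |iteratedDeriv 3 φ x| ≤ M) :
    Integrable (fun ω => φ (evalAt f X ω)) P := by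
  simp only [evalAt, hf.eval_eq]
  exact h.measurePreserving.integrable_comp_of_integrable
    (IsStandard.integrable_comp_multilinearEval (h.isStandard_map hσ) hφ hM (monomialCoeff f))

lemma IsAdmissible.integral_comp_evalAt (h : IsAdmissible P σ X) (hf : IsMultilinear f)
    (hφ : Continuous φ) :
    ∫ ω, φ (evalAt f X ω) ∂P =
      ∫ x, φ (multilinearEval (monomialCoeff f) x) ∂Measure.pi fun i => P.map (X i) := by
  have hF : Continuous (multilinearEval (monomialCoeff f)) := by
    unfold multilinearEval; fun_prop
  simp only [evalAt, hf.eval_eq]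
  rw [← h.measurePreserving.map_eq]
  exact (integral_map h.measurePreserving.measurable.aemeasurable
    (hφ.comp hF).aestronglyMeasurable).symm

end Admissible

end Invariance

open Invariance

theorem mainTheorem8 {n : ℕ} (d : ℕ)
    {Ω : Type*} [MeasurableSpace Ω] (P : Measure Ω) [IsProbabilityMeasure P]
    {Ω' : Type*} [MeasurableSpace Ω'] (P' : Measure Ω') [IsProbabilityMeasure P']
    (σ : Fin n → ℝ) (hσ : ∀ i, 0 < σ i)
    (X : Fin n → Ω → ℝ) (Y : Fin n → Ω' → ℝ)
    (hX : Invariance.IsAdmissible P σ X) (hY : Invariance.IsAdmissible P' σ Y)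
    (f : MvPolynomial (Fin n) ℝ) (hf : Invariance.IsMultilinear f) (hd : f.totalDegree ≤ d)
    (φ : ℝ → ℝ) (hφ : ContDiff ℝ 3 φ)
    (hφ3 : BddAbove (Set.range fun x => |iteratedDeriv 3 φ x|))
    (ε : ℝ)
    (hε : ∀ S : Finset (Fin n), S.Nonempty → Invariance.genInfluence σ f S ≤ ε) :
    Integrable (fun ω => φ (Invariance.evalAt f X ω)) P ∧
    Integrable (fun ω => φ (Invariance.evalAt f Y ω)) P' ∧
    |(∫ ω, φ (Invariance.evalAt f X ω) ∂P) - ∫ ω, φ (Invariance.evalAt f Y ω) ∂P'|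
      ≤ 2 ^ (5 * d) * Invariance.thirdDerivSup φ * Invariance.upWeight f ∅ * √ε := by
  have hM (x : ℝ) : |iteratedDeriv 3 φ x| ≤ thirdDerivSup φ := le_ciSup hφ3 x
  refine ⟨hX.integrable_comp_evalAt hσ hf hφ hM, hY.integrable_comp_evalAt hσ hf hφ hM, ?_⟩
  rw [hX.integral_comp_evalAt hf hφ.continuous, hY.integral_comp_evalAt hf hφ.continuous]
  refine abs_integral_pi_sub_le_of_influence_le (hX.isStandard_map hσ) (hY.isStandard_map hσ) hφ hM
    (fun J => monomialCoeff_eq_zero hd) fun S hS => ?_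
  exact (genInfluence_eq σ f S).symm.trans_le (hε S hS)
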